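/- Let $\{t\}$ denote the fractional part of $t$. For $h\in L^2(\mathbb R)$ (complex valued) let $H(y)=\int_{\mathbb R}h(x)e^{ixy}\,dx$ be its Fourier transform in the sense of Plancherel. For $\tfrac12<\sigma<1$ consider the integral equation $$h(x)=e^{\sigma x}\int_{\mathbb R}e^{-\sigma y}\{e^{y-x}\}\,\phi(y)\,dy\qquad\text{for almost every }x\in\mathbb R,\tag{E}$$ where a solution is a measurable function $\phi:\mathbb R\to\mathbb C$ that is bounded or square integrable (functions that agree almost everywhere being identified, and bounded meaning essentially bounded), and satisfies (E). (a) The Riemann hypothesis holds if and only if, for every $\sigma$ with $\tfrac12<\sigma<1$ and every $h\in L^2(\mathbb R)$, equation (E) has at most one solution, and has a solution (hence exactly one) provided that $$\frac{(\sigma+iy)H(y)}{\zeta(\sigma+iy)}\in L^2(\mathbb R).\tag{P}$$ (b) Whenever $\tfrac12<\sigma<1$, $h\in L^2(\mathbb R)$ and (P) holds, the function $$\phi(x)=-\frac1{2\pi}\int_{\mathbb R}\frac{(\sigma+iy)H(y)e^{-ixy}}{\zeta(\sigma+iy)}\,dy$$ (integral in the sense of Plancherel) is in $L^2(\mathbb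 R)$, and it is, up to equality almost everywhere, the one and only square-integrable function satisfying (E). -/

import Mathlib

open MeasureTheory
open scoped FourierTransform

noncomputable section

/-- The Plancherel (square-integrable) Fourier transform `H(y) = ∫ h(x) e^{ixy} dx`, as a
representative of its almost everywhere class. Mathlib's inverse transform is
`(𝓕⁻ h)(w) = ∫ h(x) e^{2πixw} dx`, so it is evaluated at `w = y / 2π`. -/
def fourierPlus (h : Lp ℂ 2 (volume : Measure ℝ)) (y : ℝ) : ℂ :=
  (𝓕⁻ h : Lp ℂ 2 (volume : Measure ℝ)) (y / (2 * Real.pi))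

/-- The Plancherel integral `∫ F(y) e^{-ixy} dy` of a square-integrable `F`, as a
representative of its almost everywhere class. Mathlib's transform is
`(𝓕 F)(w) = ∫ F(y) e^{-2πiyw} dy`, so it is evaluated at `w = x / 2π`. -/
def fourierMinus (F : Lp ℂ 2 (volume : Measure ℝ)) (x : ℝ) : ℂ :=
  (𝓕 F : Lp ℂ 2 (volume : Measure ℝ)) (x / (2 * Real.pi))

/-- The integral equation
`h(x) = e^{σx} ∫ e^{-σy} {e^{y-x}} φ(y) dy` for almost every `x`. -/
def SolvesEquation (σ : ℝ) (h φ : ℝ → ℂ) : Prop :=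
  ∀ᵐ x : ℝ, h x = (Real.exp (σ * x) : ℂ) *
    ∫ y : ℝ, ((Real.exp (-σ * y) * Int.fract (Real.exp (y - x)) : ℝ) : ℂ) * φ y

/-- A solution of the integral equation: a measurable function that is square integrable or
(essentially) bounded, and satisfies the equation. For `0 < σ < 1` the integral
then converges absolutely for every `x`. -/
def IsSolution (σ : ℝ) (h φ : ℝ → ℂ) : Prop :=
  (MemLp φ 2 (volume : Measure ℝ) ∨ MemLp φ ⊤ (volume : Measure ℝ)) ∧ SolvesEquation σ h φ

/-- The quotient `(σ + iy) H(y) / ζ(σ + iy)`. -/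
def zetaQuotient (σ : ℝ) (h : Lp ℂ 2 (volume : Measure ℝ)) (y : ℝ) : ℂ :=
  ((σ : ℂ) + Complex.I * y) * fourierPlus h y / riemannZeta ((σ : ℂ) + Complex.I * y)

/-- The function `-(1/2π) ∫ (σ + iy) H(y) e^{-ixy} / ζ(σ + iy) dy`, the integral being taken in
the sense of Plancherel. -/
def explicitSolution (σ : ℝ) (h : Lp ℂ 2 (volume : Measure ℝ))
    (hF : MemLp (zetaQuotient σ h) 2 (volume : Measure ℝ)) (x : ℝ) : ℂ :=
  -(1 / (2 * (Real.pi : ℂ))) * fourierMinus (hF.toLp (zetaQuotient σ h)) x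

end

/-! The substitution shows that (E) is a convolution equation `h = k * φ` with `k(u) =
e^{σu}{e^{-u}}`, a kernel decaying exponentially both ways when `0 < σ < 1`. By the Mellin formula
for the fractional part, its transform at frequency `y` is `-ζ(s)/s` with `s = σ + iy`
(`fourierInv_fractKernel`).

On `L²`, Plancherel turns (E) into `H = -(ζ(s)/s) Φ`. The zeros of zeta are countable, so one may
divide almost everywhere; (P) says exactly that the quotient is in `L²`. This gives (b) for every
`σ`, with no appeal to the Riemann hypothesis (`explicitSolution_spec`).

The hypothesis governs uniqueness among bounded functions. If `ζ` has no zero on the line, a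
Wiener-type argument shows that `k * φ = 0` forces `φ = 0` (`ae_eq_zero_of_convolution_eq_zero`). If
`ζ(σ + iτ) = 0`, then `e^{-iτy}` is a bounded nonzero solution for `h = 0` (`isSolution_zero_exp`).
The functional equation reduces the Riemann hypothesis to the strip `1/2 < Re s < 1`. -/

/-! ### Zeta as a Mellin transform of the fractional part -/

open Complex Set Filter Topology in
/-- Abel summation for the zeta function. -/
theorem riemannZeta_eq_sub_mellin_fract_of_one_lt {s : ℂ} (hs : 1 < s.re) :
    riemannZeta s = s / (s - 1) -
      s * mellin ((Ioi (1 : ℝ)).indicator fun t => ((Int.fract t : ℝ) : ℂ)) (-s) := by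
  have h1 : LSeries 1 s = s * ∫ t in Ioi (1 : ℝ), (⌊t⌋₊ : ℂ) * (t : ℂ) ^ (-(s + 1)) := by
    have := LSeries_eq_mul_integral' (1 : ℕ → ℂ) (r := 1) zero_le_one hs
      (by simpa using Asymptotics.isBigO_refl _ _)
    simpa using this
  have hI1 : IntegrableOn (fun t : ℝ => (t : ℂ) ^ (-s)) (Ioi 1) :=
    integrableOn_Ioi_cpow_of_lt (by simpa using hs) one_pos
  have hI2 : IntegrableOn (fun t : ℝ => ((Int.fract t : ℝ) : ℂ) * (t : ℂ) ^ (-(s + 1))) (Ioi 1) := by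
    have h : IntegrableOn (fun t : ℝ => (t : ℂ) ^ (-(s + 1))) (Ioi 1) :=
      integrableOn_Ioi_cpow_of_lt (by simp; linarith) one_pos
    refine h.bdd_mul (c := 1) ?_ ?_
    · exact (Complex.measurable_ofReal.comp measurable_fract).aestronglyMeasurable
    · refine ae_of_all _ fun t => ?_
      rw [Complex.norm_real, Real.norm_of_nonneg (Int.fract_nonneg t)]
      exact (Int.fract_lt_one t).le
  have h2 : ∫ t in Ioi (1 : ℝ), (⌊t⌋₊ : ℂ) * (t : ℂ) ^ (-(s + 1)) =
      (∫ t in Ioi (1 : ℝ), (t : ℂ) ^ (-s)) -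
        ∫ t in Ioi (1 : ℝ), ((Int.fract t : ℝ) : ℂ) * (t : ℂ) ^ (-(s + 1)) := by
    rw [← integral_sub hI1 hI2]
    refine setIntegral_congr_fun measurableSet_Ioi fun t ht => ?_
    have ht0 : (0 : ℝ) < t := zero_lt_one.trans ht
    have htc : (t : ℂ) ≠ 0 := by exact_mod_cast ht0.ne'
    have e1 : (t : ℂ) ^ (-s) = t * (t : ℂ) ^ (-(s + 1)) := by
      rw [show -s = 1 + -(s + 1) by ring, cpow_add _ _ htc, cpow_one]
    have e2 : ((Int.fract t : ℝ) : ℂ) = t - (⌊t⌋₊ : ℂ) := by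
      rw [Int.fract, ofReal_sub, ← natCast_floor_eq_intCast_floor ht0.le, ofReal_natCast]
    simp only [e1, e2]
    ring
  have h3 : mellin ((Ioi (1 : ℝ)).indicator fun t => ((Int.fract t : ℝ) : ℂ)) (-s) =
      ∫ t in Ioi (1 : ℝ), ((Int.fract t : ℝ) : ℂ) * (t : ℂ) ^ (-(s + 1)) := by
    rw [mellin]
    have : ∀ t : ℝ, (t : ℂ) ^ (-s - 1) • (Ioi (1 : ℝ)).indicator
        (fun t => ((Int.fract t : ℝ) : ℂ)) t =
        (Ioi (1 : ℝ)).indicator (fun t => ((Int.fract t : ℝ) : ℂ) * (t : ℂ) ^ (-(s + 1))) t := by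
      intro t
      by_cases ht : t ∈ Ioi (1 : ℝ)
      · simp only [indicator_of_mem ht, smul_eq_mul]
        rw [mul_comm, neg_add']
      · simp [indicator_of_notMem ht]
    simp_rw [this]
    rw [setIntegral_indicator measurableSet_Ioi, Ioi_inter_Ioi]
    simp
  have hs1 : s - 1 ≠ 0 := fun h => by
    rw [sub_eq_zero] at h; simp [h] at hs
  rw [← LSeries_one_eq_riemannZeta hs, h1, h2, h3,
    integral_Ioi_cpow_of_lt (by simpa using hs) one_pos, mul_sub]
  congr 1
  have : -s + 1 ≠ 0 := fun h => hs1 (by linear_combination -h)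
  simp only [ofReal_one, one_cpow]
  field_simp
  ring

-- The integrand is bounded at infinity, whence the exponent `0`, and vanishes near zero, so any
-- exponent below `s.re` serves there.
open Complex Set Filter Topology in
theorem differentiableAt_mellin_indicator_fract {s : ℂ} (hs : s.re < 0) :
    DifferentiableAt ℂ
      (mellin ((Ioi (1 : ℝ)).indicator fun t => ((Int.fract t : ℝ) : ℂ))) s := by
  have hm : Measurable ((Ioi (1 : ℝ)).indicator fun t => ((Int.fract t : ℝ) : ℂ)) :=
    (Complex.measurable_ofReal.comp measurable_fract).indicator measurableSet_Ioi
  have hb : ∀ t : ℝ, ‖(Ioi (1 : ℝ)).indicator (fun t => ((Int.fract t : ℝ) : ℂ)) t‖ ≤ 1 := by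
    intro t
    refine (norm_indicator_le_norm_self _ _).trans ?_
    rw [Complex.norm_real, Real.norm_of_nonneg (Int.fract_nonneg t)]
    exact (Int.fract_lt_one t).le
  refine mellin_differentiableAt_of_isBigO_rpow (a := 0) (b := s.re - 1) ?_ ?_ hs ?_ (by linarith)
  · refine LocallyIntegrable.locallyIntegrableOn ?_ _
    exact (locallyIntegrable_const (1 : ℝ)).mono hm.aestronglyMeasurable
      (ae_of_all _ fun t => by simpa using hb t)
  · refine Asymptotics.IsBigO.of_bound 1 (Eventually.of_forall fun t => ?_)
    simpa using hb t
  · refine Asymptotics.IsBigO.of_bound 1 ?_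
    filter_upwards [Ioo_mem_nhdsGT (zero_lt_one' ℝ)] with t ht
    rw [indicator_of_notMem (by simpa using ht.2.le)]
    simp

-- Analytic continuation from `Re s > 1`. Multiplying by `s - 1` removes the pole, so the identity
-- theorem applies on the whole right half-plane.
open Complex Set Filter Topology in
theorem riemannZeta_eq_sub_mellin_fract {s : ℂ} (hs : 0 < s.re) (hs1 : s ≠ 1) :
    riemannZeta s = s / (s - 1) -
      s * mellin ((Ioi (1 : ℝ)).indicator fun t => ((Int.fract t : ℝ) : ℂ)) (-s) := by
  set F : ℂ → ℂ := mellin ((Ioi (1 : ℝ)).indicator fun t => ((Int.fract t : ℝ) : ℂ)) with hF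
  have hU : IsOpen {z : ℂ | 0 < z.re} := isOpen_lt continuous_const continuous_re
  have hF' : DifferentiableOn ℂ (fun z => z - z * (z - 1) * F (-z)) {z : ℂ | 0 < z.re} := by
    intro z hz
    have h1 : DifferentiableAt ℂ F (-z) :=
      differentiableAt_mellin_indicator_fract (by simpa using hz)
    have h2 : DifferentiableAt ℂ (fun z => F (-z)) z := h1.comp z differentiableAt_id.neg
    exact (differentiableAt_id.sub ((differentiableAt_id.mul
      (differentiableAt_id.sub_const 1)).mul h2)).differentiableWithinAt
  have key : EqOn riemannZeta₁ (fun z => z - z * (z - 1) * F (-z)) {z : ℂ | 0 < z.re} := by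
    refine AnalyticOnNhd.eqOn_of_preconnected_of_eventuallyEq (z₀ := 2)
      (differentiable_riemannZeta₁.differentiableOn.analyticOnNhd hU)
      (hF'.analyticOnNhd hU) (convex_halfSpace_re_gt 0).isPreconnected (by simp) ?_
    have : {z : ℂ | 1 < z.re} ∈ 𝓝 (2 : ℂ) :=
      (isOpen_lt continuous_const continuous_re).mem_nhds (by simp)
    filter_upwards [this] with z hz
    have hz1 : z ≠ 1 := fun h => by simp [h] at hz
    have hz1' : z - 1 ≠ 0 := sub_ne_zero.2 hz1
    have h1 := riemannZeta_eq_inv_sub_mul hz1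
    rw [riemannZeta_eq_sub_mellin_fract_of_one_lt hz, ← hF] at h1
    field_simp at h1
    linear_combination -h1
  have := key hs
  have hs1' : s - 1 ≠ 0 := sub_ne_zero.2 hs1
  rw [riemannZeta_eq_inv_sub_mul hs1, this]
  field_simp

open Complex Set Filter Topology in
/-- The classical formula `ζ(s) = -s ∫₀^∞ {t} t^{-s-1} dt` in the critical strip. -/
theorem mellin_fract_neg {s : ℂ} (hs : 0 < s.re) (hs1 : s.re < 1) :
    mellin (fun t : ℝ => ((Int.fract t : ℝ) : ℂ)) (-s) = -(riemannZeta s / s) := by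
  have hne : s ≠ 1 := fun h => by simp [h] at hs1
  have hs0 : s ≠ 0 := fun h => by simp [h] at hs
  have hmf : AEStronglyMeasurable (fun t : ℝ => ((Int.fract t : ℝ) : ℂ)) :=
    (Complex.measurable_ofReal.comp measurable_fract).aestronglyMeasurable
  have hpow : IntegrableOn (fun t : ℝ => (t : ℂ) ^ (-s - 1)) (Ioi 1) :=
    integrableOn_Ioi_cpow_of_lt (by simp; linarith) one_pos
  have hI2 : IntegrableOn (fun t : ℝ => (t : ℂ) ^ (-s - 1) • ((Int.fract t : ℝ) : ℂ)) (Ioi 1) := by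
    refine Integrable.mul_bdd (c := 1) hpow hmf.restrict (ae_of_all _ fun t => ?_)
    rw [Complex.norm_real, Real.norm_of_nonneg (Int.fract_nonneg t)]
    exact (Int.fract_lt_one t).le
  have heq : ∀ t ∈ Ioo (0 : ℝ) 1,
      (t : ℂ) ^ (-s - 1) • ((Int.fract t : ℝ) : ℂ) = (t : ℂ) ^ (-s) := by
    intro t ht
    have htc : (t : ℂ) ≠ 0 := by exact_mod_cast ht.1.ne'
    rw [Int.fract_eq_self.2 ⟨ht.1.le, ht.2⟩, smul_eq_mul,
      show -s = (-s - 1) + 1 by ring, cpow_add _ _ htc, cpow_one, sub_add_cancel]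
  have hint : IntegrableOn (fun t : ℝ => (t : ℂ) ^ (-s)) (Ioo 0 1) := by
    have := intervalIntegral.intervalIntegrable_cpow' (a := 0) (b := 1) (r := -s)
      (by simpa using hs1)
    rw [intervalIntegrable_iff_integrableOn_Ioo_of_le zero_le_one] at this
    exact this
  have hI1 : IntegrableOn (fun t : ℝ => (t : ℂ) ^ (-s - 1) • ((Int.fract t : ℝ) : ℂ))
      (Ioc 0 1) := by
    rw [integrableOn_Ioc_iff_integrableOn_Ioo]
    exact hint.congr_fun (fun t ht => (heq t ht).symm) measurableSet_Ioo
  -- Since `{t} = t` on `(0, 1)`, this piece contributes `1/(1 - s)`, which absorbs the term `s/(s -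
  -- 1)` of the continued formula.
  have e1 : ∫ t in Ioc (0 : ℝ) 1, (t : ℂ) ^ (-s - 1) • ((Int.fract t : ℝ) : ℂ) = 1 / (1 - s) := by
    rw [integral_Ioc_eq_integral_Ioo, setIntegral_congr_fun measurableSet_Ioo heq,
      ← integral_Ioc_eq_integral_Ioo, ← intervalIntegral.integral_of_le zero_le_one,
      integral_cpow (Or.inl (by simpa using hs1))]
    have : -s + 1 ≠ 0 := fun h => hne (by linear_combination -h)
    simp [zero_cpow this]
    ring_nf
  have e2 : mellin ((Ioi (1 : ℝ)).indicator fun t => ((Int.fract t : ℝ) : ℂ)) (-s) =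
      ∫ t in Ioi (1 : ℝ), (t : ℂ) ^ (-s - 1) • ((Int.fract t : ℝ) : ℂ) := by
    rw [mellin]
    have : ∀ t : ℝ, (t : ℂ) ^ (-s - 1) • (Ioi (1 : ℝ)).indicator
        (fun t => ((Int.fract t : ℝ) : ℂ)) t =
        (Ioi (1 : ℝ)).indicator (fun t => (t : ℂ) ^ (-s - 1) • ((Int.fract t : ℝ) : ℂ)) t :=
      fun t => (indicator_smul_apply _ (fun t : ℝ => (t : ℂ) ^ (-s - 1)) _ t).symm
    simp_rw [this]
    rw [setIntegral_indicator measurableSet_Ioi, Ioi_inter_Ioi]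
    simp
  have e3 := riemannZeta_eq_sub_mellin_fract hs hne
  rw [mellin, ← Ioc_union_Ioi_eq_Ioi zero_le_one,
    setIntegral_union (Ioc_disjoint_Ioi le_rfl) measurableSet_Ioi hI1 hI2, e1, ← e2, e3]
  have h1 : s - 1 ≠ 0 := sub_ne_zero.2 hne
  have h2 : 1 - s ≠ 0 := sub_ne_zero.2 hne.symm
  field_simp
  ring

/-! ### Plancherel transforms compared with Fourier integrals -/

open SchwartzMap in
theorem integral_schwartz_mul_fourier_Lp (f : Lp ℂ 2 (volume : Measure ℝ)) (ψ : 𝓢(ℝ, ℂ)) :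
    ∫ x, ψ x * (𝓕 f : Lp ℂ 2 (volume : Measure ℝ)) x = ∫ x, (𝓕 ψ) x * f x := by
  have := congrArg (fun T : 𝓢'(ℝ, ℂ) => T ψ) (Lp.fourier_toTemperedDistribution_eq f)
  simp only [TemperedDistribution.fourier_apply, Lp.toTemperedDistribution_apply, smul_eq_mul]
    at this
  exact this.symm

open SchwartzMap in
theorem integral_schwartz_mul_fourierInv_Lp (f : Lp ℂ 2 (volume : Measure ℝ)) (ψ : 𝓢(ℝ, ℂ)) :
    ∫ x, ψ x * (𝓕⁻ f : Lp ℂ 2 (volume : Measure ℝ)) x = ∫ x, (𝓕⁻ ψ) x * f x := by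
  have := congrArg (fun T : 𝓢'(ℝ, ℂ) => T ψ) (Lp.fourierInv_toTemperedDistribution_eq f)
  simp only [TemperedDistribution.fourierInv_apply, Lp.toTemperedDistribution_apply, smul_eq_mul]
    at this
  exact this.symm

open SchwartzMap in
/-- Locally integrable functions are determined by their integrals against Schwartz functions. -/
theorem ae_eq_of_integral_schwartz_mul_eq {f g : ℝ → ℂ} (hf : LocallyIntegrable f)
    (hg : LocallyIntegrable g) (h : ∀ ψ : 𝓢(ℝ, ℂ), ∫ x, ψ x * f x = ∫ x, ψ x * g x) :
    f =ᵐ[volume] g := by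
  refine ae_eq_of_integral_contDiff_smul_eq hf hg fun ψ hψ hc => ?_
  have h1 : HasCompactSupport (Complex.ofRealCLM ∘ ψ) := hc.comp_left rfl
  have h2 : ContDiff ℝ ((⊤ : ℕ∞) : WithTop ℕ∞) (Complex.ofRealCLM ∘ ψ) := by fun_prop
  simpa using h (h1.toSchwartzMap h2)

theorem integral_fourier_mul_eq_flip {f g : ℝ → ℂ} (hf : Integrable f) (hg : Integrable g) :
    ∫ x, (𝓕 f) x * g x = ∫ x, f x * (𝓕 g) x := by
  have := VectorFourier.integral_fourierIntegral_smul_eq_flip (μ := volume) (ν := volume)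
    (L := innerₗ ℝ) Real.continuous_fourierChar continuous_inner hf hg
  rw [flip_innerₗ] at this
  exact this

theorem integral_fourierInv_mul_eq_flip {f g : ℝ → ℂ} (hf : Integrable f) (hg : Integrable g) :
    ∫ x, (𝓕⁻ f) x * g x = ∫ x, f x * (𝓕⁻ g) x := by
  have h1 := integral_fourier_mul_eq_flip hf hg.comp_neg
  have h2 : ∀ x, (𝓕 fun t => g (-t)) x = (𝓕⁻ g) x := fun x => by
    rw [Real.fourierInv_eq_fourier_comp_neg]
  simp only [h2] at h1
  rw [← h1, ← integral_neg_eq_self]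
  simp only [Real.fourierInv_eq_fourier_neg, neg_neg]

theorem continuous_fourier_of_integrable {f : ℝ → ℂ} (hf : Integrable f) : Continuous (𝓕 f) :=
  VectorFourier.fourierIntegral_continuous Real.continuous_fourierChar
    (L := innerₗ ℝ) continuous_inner hf

theorem continuous_fourierInv_of_integrable {f : ℝ → ℂ} (hf : Integrable f) :
    Continuous (𝓕⁻ f) := by
  rw [Real.fourierInv_eq_fourier_comp_neg]
  exact continuous_fourier_of_integrable hf.comp_neg

theorem norm_fourierInv_le_integral_norm (f : ℝ → ℂ) (w : ℝ) : ‖(𝓕⁻ f) w‖ ≤ ∫ x, ‖f x‖ :=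
  VectorFourier.norm_fourierIntegral_le_integral_norm _ _ _ _ _

open SchwartzMap in
/-- On `L¹ ∩ L²` the Plancherel transform is the Fourier integral. -/
theorem fourier_toLp_ae_eq {f : ℝ → ℂ} (h1 : Integrable f) (h2 : MemLp f 2) :
    (𝓕 (h2.toLp f) : Lp ℂ 2 (volume : Measure ℝ)) =ᵐ[volume] 𝓕 f := by
  refine ae_eq_of_integral_schwartz_mul_eq ((Lp.memLp _).locallyIntegrable one_le_two)
    (continuous_fourier_of_integrable h1).locallyIntegrable fun ψ => ?_
  rw [integral_schwartz_mul_fourier_Lp, ← integral_fourier_mul_eq_flip ψ.integrable h1]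
  refine integral_congr_ae ?_
  filter_upwards [h2.coeFn_toLp] with x hx
  rw [hx, SchwartzMap.fourier_coe]

open SchwartzMap in
/-- On `L¹ ∩ L²` the inverse Plancherel transform is the inverse Fourier integral. -/
theorem fourierInv_toLp_ae_eq {f : ℝ → ℂ} (h1 : Integrable f) (h2 : MemLp f 2) :
    (𝓕⁻ (h2.toLp f) : Lp ℂ 2 (volume : Measure ℝ)) =ᵐ[volume] 𝓕⁻ f := by
  refine ae_eq_of_integral_schwartz_mul_eq ((Lp.memLp _).locallyIntegrable one_le_two)
    (continuous_fourierInv_of_integrable h1).locallyIntegrable fun ψ => ?_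
  rw [integral_schwartz_mul_fourierInv_Lp, ← integral_fourierInv_mul_eq_flip ψ.integrable h1]
  refine integral_congr_ae ?_
  filter_upwards [h2.coeFn_toLp] with x hx
  rw [hx, SchwartzMap.fourierInv_coe]

/-! ### Convolution equations in `L²` -/

theorem inner_fourierInv_Lp_eq (f g : Lp ℂ 2 (volume : Measure ℝ)) :
    inner ℂ (𝓕⁻ f : Lp ℂ 2 (volume : Measure ℝ)) (𝓕⁻ g) = inner ℂ f g := by
  rw [← Lp.inner_fourier_eq, FourierTransform.fourier_fourierInv_eq,
    FourierTransform.fourier_fourierInv_eq]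

theorem fourierInv_comp_sub_left (k : ℝ → ℂ) (x w : ℝ) :
    (𝓕⁻ fun y => k (x - y)) w =
      Complex.exp (2 * Real.pi * x * w * Complex.I) * (𝓕 k) w := by
  rw [Real.fourierInv_eq', Real.fourier_eq', ← integral_const_mul,
    ← integral_sub_left_eq_self _ _ x]
  congr 1 with u
  simp only [smul_eq_mul, sub_sub_cancel, ← mul_assoc, ← Complex.exp_add]
  congr 2
  simp
  ring

theorem fourier_star (k : ℝ → ℂ) (w : ℝ) :
    (𝓕 fun y => starRingEnd ℂ (k y)) w = starRingEnd ℂ ((𝓕⁻ k) w) := by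
  rw [Real.fourierInv_eq', Real.fourier_eq', ← integral_conj]
  congr 1 with u
  simp only [smul_eq_mul, map_mul, ← Complex.exp_conj]
  congr 2
  simp [map_ofNat]

theorem memLp_two_of_integrable_of_bounded {k : ℝ → ℂ} (hk : Integrable k) {C : ℝ}
    (hC : ∀ u, ‖k u‖ ≤ C) : MemLp k 2 := by
  rw [memLp_two_iff_integrable_sq_norm hk.aestronglyMeasurable]
  simp_rw [pow_two]
  exact hk.norm.mul_bdd (c := C) hk.norm.aestronglyMeasurable
    (ae_of_all _ fun u => by simpa using hC u)

/-- Convolution of a kernel in `L¹ ∩ L²` with a function in `L²`, on the Fourier side. -/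
theorem integral_convolution_eq_fourier {k : ℝ → ℂ} (h1 : Integrable k) (h2 : MemLp k 2)
    (φ : Lp ℂ 2 (volume : Measure ℝ)) (x : ℝ) :
    ∫ y, k (x - y) * φ y =
      (𝓕 fun w => (𝓕⁻ k) w * (𝓕⁻ φ : Lp ℂ 2 (volume : Measure ℝ)) w) x := by
  -- With this conjugate, the convolution at `x` is the inner product of `g` and `φ`, and Parseval
  -- applies.
  set g : ℝ → ℂ := fun y => starRingEnd ℂ (k (x - y)) with hg
  have g1 : Integrable g := by
    have := (h1.comp_sub_left x)
    exact (Complex.conjLIE.integrable_comp_iff).2 this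
  have g2 : MemLp g 2 := by
    have : MemLp (fun y => k (x - y)) 2 :=
      h2.comp_measurePreserving (Measure.measurePreserving_sub_left volume x)
    exact this.star
  have e := inner_fourierInv_Lp_eq (g2.toLp g) φ
  rw [L2.inner_def, L2.inner_def] at e
  have e1 : ∫ y, inner ℂ ((g2.toLp g : Lp ℂ 2 (volume : Measure ℝ)) y) (φ y) =
      ∫ y, k (x - y) * φ y := by
    refine integral_congr_ae ?_
    filter_upwards [g2.coeFn_toLp] with y hy
    rw [hy, RCLike.inner_apply, hg]
    simp [mul_comm]
  rw [← e1, ← e, Real.fourier_eq']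
  refine integral_congr_ae ?_
  filter_upwards [fourierInv_toLp_ae_eq g1 g2] with w hw
  rw [hw, RCLike.inner_apply, hg, fourierInv_comp_sub_left (fun u => starRingEnd ℂ (k u)),
    fourier_star, map_mul, ← Complex.exp_conj, Complex.conj_conj, smul_eq_mul]
  rw [mul_comm, mul_assoc]
  congr 2
  simp [map_ofNat]
  ring

theorem memLp_fourierInv_mul {k : ℝ → ℂ} (h1 : Integrable k) {Φ : ℝ → ℂ} (hΦ : MemLp Φ 2) :
    MemLp (fun w => (𝓕⁻ k) w * Φ w) 2 :=
  hΦ.of_le_mul ((continuous_fourierInv_of_integrable h1).aestronglyMeasurable.mul hΦ.1)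
    (ae_of_all _ fun w => by
      rw [norm_mul]
      exact mul_le_mul_of_nonneg_right (norm_fourierInv_le_integral_norm k w) (norm_nonneg _))

/-- A convolution equation in `L²` is equivalent to a multiplicative equation for the
transforms. -/
theorem convolution_equation_iff {k : ℝ → ℂ} (h1 : Integrable k) (h2 : MemLp k 2)
    (h φ : Lp ℂ 2 (volume : Measure ℝ)) :
    (∀ᵐ x : ℝ, h x = ∫ y, k (x - y) * φ y) ↔
      ∀ᵐ w : ℝ, (𝓕⁻ h : Lp ℂ 2 (volume : Measure ℝ)) w =
        (𝓕⁻ k) w * (𝓕⁻ φ : Lp ℂ 2 (volume : Measure ℝ)) w := by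
  set Φ := (𝓕⁻ φ : Lp ℂ 2 (volume : Measure ℝ)) with hΦ
  have hk : MemLp (𝓕⁻ k) 2 := (Lp.memLp _).ae_eq (fourierInv_toLp_ae_eq h1 h2)
  -- The product is in `L¹` (two `L²` factors) and in `L²` (one factor bounded), so its Plancherel
  -- transform is the pointwise Fourier integral.
  have m1 : Integrable (fun w => (𝓕⁻ k) w * Φ w) := hk.integrable_mul (Lp.memLp Φ)
  have m2 : MemLp (fun w => (𝓕⁻ k) w * Φ w) 2 := memLp_fourierInv_mul h1 (Lp.memLp Φ)
  have key : (∀ᵐ x : ℝ, h x = ∫ y, k (x - y) * φ y) ↔ h = 𝓕 (m2.toLp _) := by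
    rw [Lp.ext_iff]
    have := fourier_toLp_ae_eq m1 m2
    constructor
    · intro H
      filter_upwards [H, this] with x hx hx'
      rw [hx, hx', integral_convolution_eq_fourier h1 h2]
    · intro H
      filter_upwards [H, this] with x hx hx'
      rw [hx, hx', integral_convolution_eq_fourier h1 h2]
  rw [key]
  have key2 : h = 𝓕 (m2.toLp _) ↔ 𝓕⁻ h = m2.toLp _ := by
    constructor
    · rintro rfl
      rw [FourierTransform.fourierInv_fourier_eq]
    · intro H
      rw [← H, FourierTransform.fourier_fourierInv_eq]
  rw [key2, Lp.ext_iff]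
  constructor
  · intro H
    filter_upwards [H, m2.coeFn_toLp] with x hx hx'
    rw [hx, hx']
  · intro H
    filter_upwards [H, m2.coeFn_toLp] with x hx hx'
    rw [hx, hx']

/-! ### The kernel: decay and transform -/

/-- The convolution kernel `e^{σu} {e^{-u}}` of the integral equation. -/
noncomputable def fractKernel (σ u : ℝ) : ℂ :=
  ((Real.exp (σ * u) * Int.fract (Real.exp (-u)) : ℝ) : ℂ)

theorem measurable_fractKernel (σ : ℝ) : Measurable (fractKernel σ) := by
  unfold fractKernel
  fun_prop

/-- Use `{e^{-u}} ≤ e^{-u}` for `u ≥ 0` and `{e^{-u}} ≤ 1` for `u ≤ 0`. -/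
theorem norm_fractKernel_le {σ : ℝ} (u : ℝ) :
    ‖fractKernel σ u‖ ≤ Real.exp (-min σ (1 - σ) * |u|) := by
  have h0 := Int.fract_nonneg (Real.exp (-u))
  rw [fractKernel, Complex.norm_real, Real.norm_of_nonneg (by positivity)]
  rcases le_total 0 u with hu | hu
  · have h1 : Int.fract (Real.exp (-u)) ≤ Real.exp (-u) := by
      rw [Int.fract]
      have : (0 : ℝ) ≤ ⌊Real.exp (-u)⌋ := by
        exact_mod_cast Int.floor_nonneg.2 (Real.exp_pos _).le
      linarith
    calc _ ≤ Real.exp (σ * u) * Real.exp (-u) := by gcongr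
      _ = Real.exp (-(1 - σ) * u) := by rw [← Real.exp_add]; ring_nf
      _ ≤ _ := by
        rw [abs_of_nonneg hu]
        gcongr
        exact min_le_right _ _
  · calc _ ≤ Real.exp (σ * u) * 1 := by gcongr; exact (Int.fract_lt_one _).le
      _ = Real.exp (-σ * -u) := by ring_nf
      _ ≤ _ := by
        rw [abs_of_nonpos hu]
        gcongr
        · linarith
        · exact min_le_left _ _

theorem integrable_one_add_sq_mul_exp_neg_abs {δ : ℝ} (hδ : 0 < δ) :
    Integrable fun u : ℝ => (1 + u ^ 2) * Real.exp (-δ * |u|) := by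
  -- The constant comes from `x^4/4! ≤ e^x` at `x = δ(1 + |u|)`.
  refine ((integrable_inv_one_add_sq).const_mul (24 / δ ^ 4 * Real.exp δ)).mono'
    (by fun_prop) (ae_of_all _ fun u => ?_)
  rw [Real.norm_of_nonneg (by positivity)]
  have h1 : (δ * (1 + |u|)) ^ 4 ≤ 24 * Real.exp (δ * (1 + |u|)) := by
    have := Real.pow_div_factorial_le_exp (δ * (1 + |u|)) (by positivity) 4
    rw [div_le_iff₀ (by positivity)] at this
    simpa [Nat.factorial, mul_comm] using this
  have h2 : (1 + u ^ 2) ^ 2 ≤ (1 + |u|) ^ 4 := by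
    have : 1 + u ^ 2 ≤ (1 + |u|) ^ 2 := by nlinarith [sq_abs u, abs_nonneg u]
    calc (1 + u ^ 2) ^ 2 ≤ ((1 + |u|) ^ 2) ^ 2 := by gcongr
      _ = _ := by ring
  rw [← div_eq_mul_inv, le_div_iff₀ (by positivity)]
  calc (1 + u ^ 2) * Real.exp (-δ * |u|) * (1 + u ^ 2)
      = (1 + u ^ 2) ^ 2 * Real.exp (-δ * |u|) := by ring
    _ ≤ (1 + |u|) ^ 4 * Real.exp (-δ * |u|) := by gcongr
    _ = (δ * (1 + |u|)) ^ 4 / δ ^ 4 * Real.exp (-δ * |u|) := by field_simp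
    _ ≤ 24 * Real.exp (δ * (1 + |u|)) / δ ^ 4 * Real.exp (-δ * |u|) := by gcongr
    _ = 24 / δ ^ 4 * (Real.exp (δ * (1 + |u|)) * Real.exp (-δ * |u|)) := by ring
    _ = 24 / δ ^ 4 * Real.exp δ := by rw [← Real.exp_add]; ring_nf

theorem integrable_one_add_sq_mul_fractKernel {σ : ℝ} (h0 : 0 < σ) (h1 : σ < 1) :
    Integrable fun u : ℝ => ((1 + u ^ 2 : ℝ) : ℂ) * fractKernel σ u := by
  have hδ : 0 < min σ (1 - σ) := lt_min h0 (by linarith)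
  refine (integrable_one_add_sq_mul_exp_neg_abs hδ).mono'
    ((by fun_prop : Measurable fun u : ℝ => ((1 + u ^ 2 : ℝ) : ℂ)).mul
      (measurable_fractKernel σ)).aestronglyMeasurable (ae_of_all _ fun u => ?_)
  rw [norm_mul, Complex.norm_real, Real.norm_of_nonneg (by positivity)]
  gcongr
  exact norm_fractKernel_le u

theorem integrable_fractKernel {σ : ℝ} (h0 : 0 < σ) (h1 : σ < 1) :
    Integrable (fractKernel σ) := by
  refine (integrable_one_add_sq_mul_fractKernel h0 h1).mono
    (measurable_fractKernel σ).aestronglyMeasurable (ae_of_all _ fun u => ?_)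
  rw [norm_mul, Complex.norm_real, Real.norm_of_nonneg (by positivity)]
  nlinarith [norm_nonneg (fractKernel σ u), sq_nonneg u]

theorem memLp_two_fractKernel {σ : ℝ} (h0 : 0 < σ) (h1 : σ < 1) : MemLp (fractKernel σ) 2 := by
  refine memLp_two_of_integrable_of_bounded (integrable_fractKernel h0 h1) (C := 1) fun u => ?_
  have hδ : 0 < min σ (1 - σ) := lt_min h0 (by linarith)
  refine (norm_fractKernel_le u).trans (Real.exp_le_one_iff.2 ?_)
  nlinarith [abs_nonneg u]

/-- The change of variable `t = e^{-u}` turns the Mellin transform at `-s` into a Fourier transform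
along `Re s = σ`. -/
theorem fourierInv_fractKernel {σ : ℝ} (h0 : 0 < σ) (h1 : σ < 1) (w : ℝ) :
    (𝓕⁻ (fractKernel σ)) w =
      -(riemannZeta (σ + Complex.I * (2 * Real.pi * w : ℝ)) /
        (σ + Complex.I * (2 * Real.pi * w : ℝ))) := by
  rw [← mellin_fract_neg (by simpa using h0) (by simpa using h1), mellin_eq_fourier,
    Real.fourierInv_eq_fourier_neg]
  have e : (fun u : ℝ => Real.exp (-(-((σ : ℂ) + Complex.I * (2 * Real.pi * w : ℝ))).re * u) •
      ((Int.fract (Real.exp (-u)) : ℝ) : ℂ)) = fractKernel σ := by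
    ext u
    simp [fractKernel]
  rw [e]
  simp
  field_simp

theorem solvesEquation_iff (σ : ℝ) (h φ : ℝ → ℂ) :
    SolvesEquation σ h φ ↔ ∀ᵐ x : ℝ, h x = ∫ y, fractKernel σ (x - y) * φ y := by
  have : ∀ x : ℝ, (Real.exp (σ * x) : ℂ) *
      ∫ y : ℝ, ((Real.exp (-σ * y) * Int.fract (Real.exp (y - x)) : ℝ) : ℂ) * φ y =
      ∫ y, fractKernel σ (x - y) * φ y := by
    intro x
    rw [← integral_const_mul]
    congr 1 with y
    rw [← mul_assoc, fractKernel, neg_sub, ← Complex.ofReal_mul, ← mul_assoc, ← Real.exp_add]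
    ring_nf
  simp only [SolvesEquation, this]

theorem solvesEquation_congr {σ : ℝ} {h φ ψ : ℝ → ℂ} (H : φ =ᵐ[volume] ψ) :
    SolvesEquation σ h φ ↔ SolvesEquation σ h ψ := by
  have : ∀ x : ℝ, ∫ y, fractKernel σ (x - y) * φ y = ∫ y, fractKernel σ (x - y) * ψ y := by
    intro x
    refine integral_congr_ae ?_
    filter_upwards [H] with y hy
    rw [hy]
  simp only [solvesEquation_iff, this]

/-! ### The explicit square-integrable solution -/

theorem memLp_comp_mul_left {f : ℝ → ℂ} {c : ℝ} (hc : c ≠ 0) (hf : MemLp f 2) :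
    MemLp (fun x => f (c * x)) 2 := by
  have : MemLp f 2 (Measure.map (fun x : ℝ => c * x) volume) := by
    rw [Real.map_volume_mul_left hc]
    exact hf.smul_measure ENNReal.ofReal_ne_top
  exact this.comp_of_map (measurable_const_mul c).aemeasurable

theorem fourier_comp_mul_left (f : ℝ → ℂ) {c : ℝ} (hc : 0 < c) (w : ℝ) :
    (𝓕 fun x => f (c * x)) w = ((c⁻¹ : ℝ) : ℂ) * (𝓕 f) (c⁻¹ * w) := by
  rw [Real.fourier_eq', Real.fourier_eq']
  have := Measure.integral_comp_mul_left (fun v : ℝ =>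
    Complex.exp ((-2 * Real.pi * inner ℝ v (c⁻¹ * w) : ℝ) * Complex.I) • f v) c
  rw [abs_of_pos (inv_pos.2 hc), Complex.real_smul] at this
  rw [← this]
  congr 1 with v
  congr 4
  simp
  field_simp

open SchwartzMap in
/-- Rescaling for the Plancherel transform. -/
theorem fourier_toLp_comp_mul_left {F : ℝ → ℂ} (hF : MemLp F 2) {c : ℝ} (hc : 0 < c)
    (hF' : MemLp (fun x => F (c * x)) 2) :
    (𝓕 (hF'.toLp _) : Lp ℂ 2 (volume : Measure ℝ)) =ᵐ[volume] fun x =>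
      ((c⁻¹ : ℝ) : ℂ) * (𝓕 (hF.toLp F) : Lp ℂ 2 (volume : Measure ℝ)) (c⁻¹ * x) := by
  set G := (𝓕 (hF.toLp F) : Lp ℂ 2 (volume : Measure ℝ))
  have hc' : c⁻¹ ≠ 0 := (inv_pos.2 hc).ne'
  refine ae_eq_of_integral_schwartz_mul_eq ((Lp.memLp _).locallyIntegrable one_le_two)
    (((memLp_comp_mul_left hc' (Lp.memLp G)).const_mul _).locallyIntegrable one_le_two)
    fun ψ => ?_
  -- The dilation is moved onto the test function, where the Fourier integral rescales classically.
  let e : ℝ ≃L[ℝ] ℝ := ContinuousLinearEquiv.unitsEquivAut ℝ (Units.mk0 c hc.ne')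
  let ψc : 𝓢(ℝ, ℂ) := compCLMOfContinuousLinearEquiv ℂ e ψ
  have hψc : ∀ x, ψc x = ψ (c * x) := fun x => by
    simp [ψc, e, mul_comm]
  have hFψc : ∀ w, (𝓕 ψc) w = ((c⁻¹ : ℝ) : ℂ) * (𝓕 ψ) (c⁻¹ * w) := fun w => by
    rw [SchwartzMap.fourier_coe, SchwartzMap.fourier_coe, ← fourier_comp_mul_left _ hc]
    exact congrArg (fun f : ℝ → ℂ => (𝓕 f) w) (funext hψc)
  have e1 : ∫ x, ψ x * (((c⁻¹ : ℝ) : ℂ) * G (c⁻¹ * x)) = ∫ x, ψc x * G x := by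
    have := Measure.integral_comp_mul_left (fun x : ℝ => ψ (c * x) * G x) c⁻¹
    rw [inv_inv, abs_of_pos hc, Complex.real_smul] at this
    simp only [hψc]
    have h2 : ∫ x, ψ x * (((c⁻¹ : ℝ) : ℂ) * G (c⁻¹ * x)) =
        ((c⁻¹ : ℝ) : ℂ) * ∫ x, ψ (c * (c⁻¹ * x)) * G (c⁻¹ * x) := by
      rw [← integral_const_mul]
      congr 1 with x
      rw [mul_inv_cancel_left₀ hc.ne']
      ring
    rw [h2, this, ← mul_assoc, ← Complex.ofReal_mul, inv_mul_cancel₀ hc.ne']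
    simp
  have e2 : ∫ w, (𝓕 ψc) w * (hF.toLp F : Lp ℂ 2 (volume : Measure ℝ)) w =
      ∫ w, (𝓕 ψ) w * F (c * w) := by
    have := Measure.integral_comp_mul_left (fun w : ℝ => (𝓕 ψ) (c⁻¹ * w) * F w) c
    rw [abs_of_pos (inv_pos.2 hc), Complex.real_smul, ← integral_const_mul] at this
    simp only [inv_mul_cancel_left₀ hc.ne'] at this
    rw [this]
    refine integral_congr_ae ?_
    filter_upwards [hF.coeFn_toLp] with w hw
    rw [hw, hFψc]
    ring
  rw [integral_schwartz_mul_fourier_Lp, e1, integral_schwartz_mul_fourier_Lp, e2]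
  refine integral_congr_ae ?_
  filter_upwards [hF'.coeFn_toLp] with w hw
  rw [hw]

theorem countable_riemannZetaZeros : riemannZetaZeros.Countable :=
  (HereditarilyLindelofSpace.isLindelof _).countable isDiscrete_riemannZetaZeros.to_subtype

theorem ae_riemannZeta_vertical_ne_zero (σ : ℝ) :
    ∀ᵐ w : ℝ, riemannZeta (σ + Complex.I * (2 * Real.pi * w : ℝ)) ≠ 0 := by
  have hinj : Function.Injective fun w : ℝ =>
      (σ : ℂ) + Complex.I * (2 * Real.pi * w : ℝ) := by
    intro a b hab
    simpa [Real.pi_ne_zero] using hab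
  have := (countable_riemannZetaZeros.preimage hinj).measure_zero volume
  rw [measure_eq_zero_iff_ae_notMem] at this
  exact this

/-- Almost everywhere on the line the multiplier `-ζ(s)/s` is invertible, so the transformed
equation determines the transform of `φ`. The factor `1/2π` comes from rescaling the frequency. -/
theorem explicitSolution_spec {σ : ℝ} (h0 : 0 < σ) (h1 : σ < 1)
    (h : Lp ℂ 2 (volume : Measure ℝ)) (hF : MemLp (zetaQuotient σ h) 2 (volume : Measure ℝ)) :
    MemLp (explicitSolution σ h hF) 2 (volume : Measure ℝ) ∧
      ∀ φ : ℝ → ℂ, MemLp φ 2 (volume : Measure ℝ) →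
        (SolvesEquation σ h φ ↔ φ =ᵐ[volume] explicitSolution σ h hF) := by
  have hpi : 0 < 2 * Real.pi := by positivity
  have hq : MemLp (fun w => zetaQuotient σ h (2 * Real.pi * w)) 2 :=
    memLp_comp_mul_left hpi.ne' hF
  set E : Lp ℂ 2 (volume : Measure ℝ) := 𝓕 (-(hq.toLp _)) with hE
  have hEs : explicitSolution σ h hF =ᵐ[volume] E := by
    have e1 : E = -(𝓕 (hq.toLp _) : Lp ℂ 2 (volume : Measure ℝ)) :=
      map_neg (Lp.fourierTransformₗᵢ ℝ ℂ) _
    rw [e1]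
    filter_upwards [Lp.coeFn_neg (𝓕 (hq.toLp _) : Lp ℂ 2 (volume : Measure ℝ)),
      fourier_toLp_comp_mul_left hF hpi hq] with x hx hx'
    rw [hx, Pi.neg_apply, hx', explicitSolution, fourierMinus, div_eq_inv_mul x]
    push_cast
    ring
  refine ⟨(Lp.memLp E).ae_eq hEs.symm, fun φ hφ => ?_⟩
  have hφL := hφ.coeFn_toLp
  rw [← solvesEquation_congr hφL, solvesEquation_iff,
    convolution_equation_iff (integrable_fractKernel h0 h1) (memLp_two_fractKernel h0 h1)]
  have e2 : φ =ᵐ[volume] explicitSolution σ h hF ↔ hφ.toLp φ = E := by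
    rw [Lp.ext_iff]
    exact ⟨fun H => (hφL.trans H).trans hEs, fun H => (hφL.symm.trans H).trans hEs.symm⟩
  have e3 : hφ.toLp φ = E ↔ (𝓕⁻ (hφ.toLp φ) : Lp ℂ 2 (volume : Measure ℝ)) = -(hq.toLp _) := by
    constructor
    · intro H
      rw [H, hE, FourierTransform.fourierInv_fourier_eq]
    · intro H
      rw [hE, ← H, FourierTransform.fourier_fourierInv_eq]
  rw [e2, e3, Lp.ext_iff]
  have hs : ∀ w : ℝ, (σ : ℂ) + Complex.I * (2 * Real.pi * w : ℝ) ≠ 0 := fun w H => by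
    have := congrArg Complex.re H
    simp at this
    exact h0.ne' this
  have hpt : ∀ᵐ w : ℝ, ((𝓕⁻ h : Lp ℂ 2 (volume : Measure ℝ)) w = (𝓕⁻ (fractKernel σ)) w *
      (𝓕⁻ (hφ.toLp φ) : Lp ℂ 2 (volume : Measure ℝ)) w ↔
      (𝓕⁻ (hφ.toLp φ) : Lp ℂ 2 (volume : Measure ℝ)) w =
        (-(hq.toLp _) : Lp ℂ 2 (volume : Measure ℝ)) w) := by
    filter_upwards [Lp.coeFn_neg (hq.toLp _), hq.coeFn_toLp,
      ae_riemannZeta_vertical_ne_zero σ] with w hw1 hw2 hw3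
    rw [hw1, Pi.neg_apply, hw2, fourierInv_fractKernel h0 h1, zetaQuotient, fourierPlus,
      mul_div_cancel_left₀ w hpi.ne']
    have := hs w
    generalize (σ : ℂ) + Complex.I * (2 * Real.pi * w : ℝ) = s at *
    constructor
    · intro H
      rw [H]
      field_simp
    · intro H
      rw [H]
      field_simp
  constructor
  · intro H
    filter_upwards [H, hpt] with w hw hw'
    exact hw'.1 hw
  · intro H
    filter_upwards [H, hpt] with w hw hw'
    exact hw'.2 hw

/-! ### Uniqueness: a Wiener-type theorem -/

open SchwartzMap in
theorem SchwartzMap.exists_one_add_sq_mul_norm_le (m : 𝓢(ℝ, ℂ)) :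
    ∃ C, ∀ x, (1 + x ^ 2) * ‖m x‖ ≤ C := by
  obtain ⟨A, -, hA⟩ := m.decay 0 0
  obtain ⟨B, -, hB⟩ := m.decay 2 0
  refine ⟨A + B, fun x => ?_⟩
  have h1 := hA x
  have h2 := hB x
  simp only [norm_iteratedFDeriv_zero, Real.norm_eq_abs, sq_abs, pow_zero, one_mul] at h1 h2
  linarith

theorem integrable_mul_of_one_add_sq_mul_norm_le {φ m : ℝ → ℂ}
    (hφ : Integrable fun y => φ y * (((1 + y ^ 2)⁻¹ : ℝ) : ℂ)) (hm : Continuous m) {C : ℝ}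
    (hC : ∀ x, (1 + x ^ 2) * ‖m x‖ ≤ C) : Integrable fun y => φ y * m y := by
  have h : Integrable fun y => (φ y * (((1 + y ^ 2)⁻¹ : ℝ) : ℂ)) * (((1 + y ^ 2 : ℝ) : ℂ) * m y) := by
    refine hφ.mul_bdd (c := C) (by fun_prop) (ae_of_all _ fun y => ?_)
    rw [norm_mul, Complex.norm_real, Real.norm_of_nonneg (by positivity)]
    exact hC y
  refine h.congr (ae_of_all _ fun y => ?_)
  have : ((1 + y ^ 2 : ℝ) : ℂ) ≠ 0 := by
    exact_mod_cast (by positivity : (0 : ℝ) < 1 + y ^ 2).ne'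
  simp only [Complex.ofReal_inv]
  field_simp

/-- Fubini for a convolution paired with a rapidly decreasing function. -/
theorem integral_convolution_mul_eq {k φ m : ℝ → ℂ}
    (hk : Integrable fun u => ((1 + u ^ 2 : ℝ) : ℂ) * k u)
    (hφ : Integrable fun y => φ y * (((1 + y ^ 2)⁻¹ : ℝ) : ℂ)) (hm : Continuous m) {C : ℝ}
    (hC : ∀ x, (1 + x ^ 2) * ‖m x‖ ≤ C) :
    ∫ x, m x * ∫ y, k (x - y) * φ y = ∫ y, φ y * ∫ x, m x * k (x - y) := by
  have hI := hφ.convolution_integrand (ContinuousLinearMap.mul ℂ ℂ) hk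
  have hb : Integrable (fun p : ℝ × ℝ => m p.1 * (k (p.1 - p.2) * φ p.2))
      (volume.prod volume) := by
    have := hI.mul_bdd (c := 2 * C)
      (g := fun p : ℝ × ℝ => m p.1 * (((1 + p.2 ^ 2) * (1 + (p.1 - p.2) ^ 2)⁻¹ : ℝ) : ℂ)) ?_ ?_
    · refine this.congr (ae_of_all _ fun p => ?_)
      have h1 : ((1 + p.2 ^ 2 : ℝ) : ℂ) ≠ 0 := by
        exact_mod_cast (by positivity : (0 : ℝ) < 1 + p.2 ^ 2).ne'
      have h2 : ((1 + (p.1 - p.2) ^ 2 : ℝ) : ℂ) ≠ 0 := by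
        exact_mod_cast (by positivity : (0 : ℝ) < 1 + (p.1 - p.2) ^ 2).ne'
      simp only [ContinuousLinearMap.mul_apply', Complex.ofReal_inv, Complex.ofReal_mul]
      field_simp
    · refine Continuous.aestronglyMeasurable ?_
      refine (hm.comp continuous_fst).mul (Complex.continuous_ofReal.comp ?_)
      exact Continuous.mul (by fun_prop) (Continuous.inv₀ (by fun_prop) fun p => by positivity)
    · refine ae_of_all _ fun p => ?_
      rw [norm_mul, Complex.norm_real, Real.norm_of_nonneg (by positivity), ← div_eq_mul_inv,
        ← mul_div_assoc, div_le_iff₀ (by positivity)]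
      -- A Peetre-type inequality: the decay of `m` and of `k` together pays for the growth of the
      -- weight in `y`.
      have h1 : 1 + p.2 ^ 2 ≤ 2 * (1 + p.1 ^ 2) * (1 + (p.1 - p.2) ^ 2) := by
        nlinarith [sq_nonneg (p.1 + (p.1 - p.2)), sq_nonneg (p.1 * (p.1 - p.2))]
      calc ‖m p.1‖ * (1 + p.2 ^ 2)
          ≤ ‖m p.1‖ * (2 * (1 + p.1 ^ 2) * (1 + (p.1 - p.2) ^ 2)) := by gcongr
        _ = 2 * ((1 + p.1 ^ 2) * ‖m p.1‖) * (1 + (p.1 - p.2) ^ 2) := by ring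
        _ ≤ 2 * C * (1 + (p.1 - p.2) ^ 2) := by gcongr; exact hC _
  simp_rw [← integral_const_mul]
  rw [integral_integral_swap hb]
  congr 1 with y
  congr 1 with x
  ring

open scoped ContDiff in
open SchwartzMap in
/-- If `k * φ = 0` and the transform of `k` is smooth and nowhere zero, then the spectrum of `φ`
is empty. -/
theorem integral_mul_fourierInv_eq_zero {k φ : ℝ → ℂ} (hk1 : Integrable k)
    (hk : Integrable fun u => ((1 + u ^ 2 : ℝ) : ℂ) * k u)
    (hks : ContDiff ℝ ∞ (𝓕⁻ k)) (hk0 : ∀ w, (𝓕⁻ k) w ≠ 0)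
    (hφ : Integrable fun y => φ y * (((1 + y ^ 2)⁻¹ : ℝ) : ℂ))
    (hconv : ∀ᵐ x : ℝ, ∫ y, k (x - y) * φ y = 0)
    {ψ : ℝ → ℂ} (hψ : ContDiff ℝ ∞ ψ) (hψc : HasCompactSupport ψ) :
    ∫ y, φ y * (𝓕⁻ ψ) y = 0 := by
  -- Dividing `ψ` by the transform of `k` gives a test function `a`; pairing `𝓕⁻ a` with `k * φ`
  -- then amounts to pairing `𝓕⁻ ψ` with `φ`.
  have ha : ContDiff ℝ ∞ fun w => ((𝓕⁻ k) w)⁻¹ * ψ w := (hks.inv hk0).mul hψ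
  have hac : HasCompactSupport fun w => ((𝓕⁻ k) w)⁻¹ * ψ w := hψc.mul_left
  set a : 𝓢(ℝ, ℂ) := hac.toSchwartzMap ha with ha'
  obtain ⟨C, hC⟩ := (𝓕⁻ a).exists_one_add_sq_mul_norm_le
  have key := integral_convolution_mul_eq hk hφ (𝓕⁻ a).continuous hC
  have h0 : ∫ x, (𝓕⁻ a) x * ∫ y, k (x - y) * φ y = 0 := by
    refine integral_eq_zero_of_ae ?_
    filter_upwards [hconv] with x hx
    simp [hx]
  rw [h0] at key
  rw [key]
  congr 1 with y
  congr 1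
  have hflip := integral_fourierInv_mul_eq_flip a.integrable (hk1.comp_sub_right y)
  rw [← SchwartzMap.fourierInv_coe] at hflip
  rw [hflip, Real.fourierInv_eq']
  congr 1 with w
  have hshift : (𝓕⁻ fun x => k (x - y)) w =
      Complex.exp (2 * Real.pi * y * w * Complex.I) * (𝓕⁻ k) w := by
    rw [Real.fourierInv_eq', Real.fourierInv_eq', ← integral_const_mul,
      ← integral_add_right_eq_self _ y]
    congr 1 with u
    simp only [smul_eq_mul, add_sub_cancel_right, ← mul_assoc, ← Complex.exp_add]
    congr 2
    simp
    ring
  rw [hshift]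
  have : a w = ((𝓕⁻ k) w)⁻¹ * ψ w := rfl
  rw [this]
  have := hk0 w
  field_simp
  rw [smul_eq_mul, mul_comm]
  congr 2
  simp
  ring

open SchwartzMap in
theorem ae_eq_zero_of_fourier_eq_zero {f : ℝ → ℂ} (hf : Integrable f) (h : ∀ t, (𝓕 f) t = 0) :
    f =ᵐ[volume] 0 := by
  refine ae_eq_of_integral_schwartz_mul_eq hf.locallyIntegrable
    (integrable_zero ℝ ℂ volume).locallyIntegrable fun ψ => ?_
  have h1 := integral_fourier_mul_eq_flip (𝓕⁻ ψ).integrable hf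
  rw [← SchwartzMap.fourier_coe, FourierTransform.fourier_fourierInv_eq] at h1
  rw [h1]
  simp [h]

open scoped ContDiff in
open SchwartzMap in
/-- A form of Wiener's theorem: if the transform of `k` is smooth and nowhere zero, then `k * φ = 0`
only for `φ = 0`. -/
theorem ae_eq_zero_of_convolution_eq_zero {k φ : ℝ → ℂ} (hk1 : Integrable k)
    (hk : Integrable fun u => ((1 + u ^ 2 : ℝ) : ℂ) * k u)
    (hks : ContDiff ℝ ∞ (𝓕⁻ k)) (hk0 : ∀ w, (𝓕⁻ k) w ≠ 0)
    (hφ : Integrable fun y => φ y * (((1 + y ^ 2)⁻¹ : ℝ) : ℂ))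
    (hconv : ∀ᵐ x : ℝ, ∫ y, k (x - y) * φ y = 0) : φ =ᵐ[volume] 0 := by
  -- Translating `ψ` modulates `𝓕⁻ ψ`, so the vanishing integrals say that the Fourier transform of
  -- the integrable function `φ · 𝓕⁻ ψ` is zero everywhere.
  have step : ∀ ψ : ℝ → ℂ, ContDiff ℝ ∞ ψ → HasCompactSupport ψ →
      ∀ᵐ y : ℝ, φ y * (𝓕⁻ ψ) y = 0 := by
    intro ψ hψ hψc
    obtain ⟨C, hC⟩ := (𝓕⁻ (hψc.toSchwartzMap hψ)).exists_one_add_sq_mul_norm_le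
    have hcoe : ((𝓕⁻ (hψc.toSchwartzMap hψ) : 𝓢(ℝ, ℂ)) : ℝ → ℂ) = 𝓕⁻ ψ :=
      SchwartzMap.fourierInv_coe _
    have hcont := (𝓕⁻ (hψc.toSchwartzMap hψ)).continuous
    rw [hcoe] at hC hcont
    refine ae_eq_zero_of_fourier_eq_zero
      (integrable_mul_of_one_add_sq_mul_norm_le hφ hcont hC) fun t => ?_
    rw [← integral_mul_fourierInv_eq_zero hk1 hk hks hk0 hφ hconv
      (ψ := fun w => ψ (w + t)) (hψ.comp (contDiff_id.add contDiff_const))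
      (hψc.comp_homeomorph (Homeomorph.addRight t)), Real.fourier_eq']
    congr 1 with y
    have : (𝓕⁻ fun w => ψ (w + t)) y =
        Complex.exp (-2 * Real.pi * t * y * Complex.I) * (𝓕⁻ ψ) y := by
      rw [Real.fourierInv_eq', Real.fourierInv_eq', ← integral_const_mul,
        ← integral_sub_right_eq_self _ t]
      congr 1 with u
      simp only [smul_eq_mul, sub_add_cancel, ← mul_assoc, ← Complex.exp_add]
      congr 2
      simp
      ring
    rw [this, smul_eq_mul, mul_left_comm]
    congr 2
    simp [mul_assoc]
  let χ : ContDiffBump (0 : ℝ) := default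
  set c : ℝ → ℂ := fun w => ((χ w : ℝ) : ℂ) with hc
  have hcs : ContDiff ℝ ∞ c := Complex.ofRealCLM.contDiff.comp χ.contDiff
  have hcc : HasCompactSupport c := χ.hasCompactSupport.comp_left (g := Complex.ofReal) rfl
  have hρ : Continuous (𝓕⁻ c) :=
    continuous_fourierInv_of_integrable (hcs.continuous.integrable_of_hasCompactSupport hcc)
  have hρ0 : (𝓕⁻ c) 0 ≠ 0 := by
    rw [Real.fourierInv_eq']
    simp only [inner_zero_right, mul_zero, Complex.ofReal_zero, zero_mul, Complex.exp_zero,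
      one_smul, hc]
    rw [integral_complex_ofReal]
    exact_mod_cast χ.integral_pos.ne'
  -- Modulating `c` translates `𝓕⁻ c`, which is nonzero near `0`. Rational translates keep the
  -- exceptional set null and still bring every `y` within `δ` of the centre.
  have hall : ∀ᵐ y : ℝ, ∀ q : ℚ, φ y * (𝓕⁻ c) (y - q) = 0 := by
    rw [ae_all_iff]
    intro q
    have hmod : ContDiff ℝ ∞ fun w : ℝ =>
        Complex.exp (-2 * Real.pi * q * w * Complex.I) * c w := by
      refine ContDiff.mul ?_ hcs
      have : ContDiff ℝ ∞ fun w : ℝ => (w : ℂ) := Complex.ofRealCLM.contDiff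
      fun_prop
    filter_upwards [step _ hmod hcc.mul_left] with y hy
    rw [← hy]
    congr 1
    rw [Real.fourierInv_eq', Real.fourierInv_eq']
    congr 1 with w
    simp only [smul_eq_mul, ← mul_assoc, ← Complex.exp_add]
    congr 2
    simp
    ring
  obtain ⟨δ, hδ, hδ'⟩ := Metric.eventually_nhds_iff.1 (hρ.continuousAt.eventually_ne hρ0)
  filter_upwards [hall] with y hy
  obtain ⟨q, hq1, hq2⟩ := exists_rat_btwn (show y - δ < y by linarith)
  refine (mul_eq_zero.1 (hy q)).resolve_right (hδ' ?_)
  rw [dist_zero_right, Real.norm_eq_abs, abs_lt]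
  constructor <;> linarith

open scoped ContDiff in
theorem contDiff_fourierInv_fractKernel {σ : ℝ} (h0 : 0 < σ) (h1 : σ < 1) :
    ContDiff ℝ ∞ (𝓕⁻ (fractKernel σ)) := by
  have e : 𝓕⁻ (fractKernel σ) = fun w : ℝ =>
      -(riemannZeta (σ + Complex.I * (2 * Real.pi * w : ℝ)) /
        (σ + Complex.I * (2 * Real.pi * w : ℝ))) := funext (fourierInv_fractKernel h0 h1)
  have hl : ContDiff ℝ ∞ fun w : ℝ => (σ : ℂ) + Complex.I * (2 * Real.pi * w : ℝ) :=
    contDiff_const.add (contDiff_const.mul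
      (Complex.ofRealCLM.contDiff.comp (contDiff_const.mul contDiff_id)))
  rw [e, contDiff_iff_contDiffAt]
  intro w
  have hs1 : (σ : ℂ) + Complex.I * (2 * Real.pi * w : ℝ) ≠ 1 := fun H => by
    have := congrArg Complex.re H
    simp at this
    linarith
  have hs0 : (σ : ℂ) + Complex.I * (2 * Real.pi * w : ℝ) ≠ 0 := fun H => by
    have := congrArg Complex.re H
    simp at this
    linarith
  have hz : ContDiffAt ℝ ∞ riemannZeta (σ + Complex.I * (2 * Real.pi * w : ℝ)) :=
    ((analyticOn_riemannZeta _ hs1).contDiffAt (n := ∞)).restrict_scalars ℝ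
  simp_rw [div_eq_mul_inv]
  exact ((hz.comp w hl.contDiffAt).mul (hl.contDiffAt.inv hs0)).neg

theorem memLp_two_inv_one_add_sq :
    MemLp (fun y : ℝ => (((1 + y ^ 2)⁻¹ : ℝ) : ℂ)) 2 := by
  refine memLp_two_of_integrable_of_bounded (integrable_inv_one_add_sq).ofReal (C := 1)
    fun y => ?_
  rw [Complex.norm_real, Real.norm_of_nonneg (by positivity)]
  exact inv_le_one_of_one_le₀ (by nlinarith [sq_nonneg y])

theorem integrable_mul_of_memLp_two_or_top {k φ : ℝ → ℂ} (h1 : Integrable k) (h2 : MemLp k 2)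
    (hφ : MemLp φ 2 (volume : Measure ℝ) ∨ MemLp φ ⊤ (volume : Measure ℝ)) :
    Integrable fun y => k y * φ y := by
  rcases hφ with hφ | hφ
  · exact h2.integrable_mul hφ
  · exact h1.mul_of_top_left hφ

/-- One solution may be bounded and the other in `L²`, so the difference need be neither;
integrability against `1/(1 + y²)` covers all cases. -/
theorem IsSolution.ae_eq {σ : ℝ} (h0 : 0 < σ) (h1 : σ < 1)
    (hζ : ∀ s : ℂ, s.re = σ → riemannZeta s ≠ 0) {h φ₁ φ₂ : ℝ → ℂ}
    (hφ₁ : IsSolution σ h φ₁) (hφ₂ : IsSolution σ h φ₂) : φ₁ =ᵐ[volume] φ₂ := by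
  have hI : ∀ {φ : ℝ → ℂ}, MemLp φ 2 (volume : Measure ℝ) ∨ MemLp φ ⊤ (volume : Measure ℝ) →
      ∀ x, Integrable fun y => fractKernel σ (x - y) * φ y := fun hφ x =>
    integrable_mul_of_memLp_two_or_top ((integrable_fractKernel h0 h1).comp_sub_left x)
      ((memLp_two_fractKernel h0 h1).comp_measurePreserving
        (Measure.measurePreserving_sub_left volume x)) hφ
  have hW : ∀ {φ : ℝ → ℂ}, MemLp φ 2 (volume : Measure ℝ) ∨ MemLp φ ⊤ (volume : Measure ℝ) →
      Integrable fun y => φ y * (((1 + y ^ 2)⁻¹ : ℝ) : ℂ) := fun hφ =>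
    (integrable_mul_of_memLp_two_or_top (integrable_inv_one_add_sq).ofReal
      memLp_two_inv_one_add_sq hφ).congr (ae_of_all _ fun y => mul_comm _ _)
  have hW' : Integrable fun y => (φ₁ y - φ₂ y) * (((1 + y ^ 2)⁻¹ : ℝ) : ℂ) :=
    ((hW hφ₁.1).sub (hW hφ₂.1)).congr (ae_of_all _ fun y => (sub_mul _ _ _).symm)
  have hne : ∀ w, (𝓕⁻ (fractKernel σ)) w ≠ 0 := by
    intro w
    rw [fourierInv_fractKernel h0 h1]
    refine neg_ne_zero.2 (div_ne_zero (hζ _ (by simp)) fun H => ?_)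
    have := congrArg Complex.re H
    simp at this
    linarith
  have hconv : ∀ᵐ x : ℝ, ∫ y, fractKernel σ (x - y) * (φ₁ y - φ₂ y) = 0 := by
    filter_upwards [(solvesEquation_iff σ h φ₁).1 hφ₁.2, (solvesEquation_iff σ h φ₂).1 hφ₂.2]
      with x hx1 hx2
    simp_rw [mul_sub]
    rw [integral_sub (hI hφ₁.1 x) (hI hφ₂.1 x), ← hx1, ← hx2, sub_self]
  have := ae_eq_zero_of_convolution_eq_zero (integrable_fractKernel h0 h1)
    (integrable_one_add_sq_mul_fractKernel h0 h1) (contDiff_fourierInv_fractKernel h0 h1) hne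
    hW' hconv
  filter_upwards [this] with y hy
  exact sub_eq_zero.1 hy

/-! ### Zeros off the critical line -/

/-- A zero of zeta on the line `Re s = σ` gives a bounded nonzero solution of the homogeneous
equation. -/
theorem isSolution_zero_exp {σ τ : ℝ} (h0 : 0 < σ) (h1 : σ < 1)
    (hζ : riemannZeta (σ + Complex.I * τ) = 0) :
    IsSolution σ ((0 : Lp ℂ 2 (volume : Measure ℝ)) : ℝ → ℂ)
      fun y => Complex.exp (-(τ * y : ℝ) * Complex.I) := by
  refine ⟨Or.inr (memLp_top_of_bound (by fun_prop) 1 (ae_of_all _ fun y => ?_)), ?_⟩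
  · rw [← Complex.ofReal_neg, Complex.norm_exp_ofReal_mul_I]
  · rw [solvesEquation_iff]
    filter_upwards [Lp.coeFn_zero ℂ 2 (volume : Measure ℝ)] with x hx
    rw [hx, Pi.zero_apply]
    -- The exponential is an eigenfunction of convolution by the kernel, and this transform value is
    -- its eigenvalue.
    have h2 : (𝓕⁻ (fractKernel σ)) (τ / (2 * Real.pi)) = 0 := by
      rw [fourierInv_fractKernel h0 h1, mul_div_cancel₀ τ (by positivity), hζ]
      simp
    rw [← integral_sub_left_eq_self _ _ x]
    have h3 : ∀ u : ℝ, fractKernel σ (x - (x - u)) *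
        Complex.exp (-(τ * (x - u) : ℝ) * Complex.I) =
        Complex.exp (-(τ * x : ℝ) * Complex.I) *
          (Complex.exp ((2 * Real.pi * inner ℝ u (τ / (2 * Real.pi)) : ℝ) * Complex.I) •
            fractKernel σ u) := by
      intro u
      rw [sub_sub_cancel, smul_eq_mul, ← mul_assoc, ← Complex.exp_add, mul_comm]
      congr 2
      have : (2 * Real.pi * inner ℝ u (τ / (2 * Real.pi)) : ℝ) = τ * u := by
        simp
        field_simp
      rw [this]
      push_cast
      ring
    simp_rw [h3]
    rw [integral_const_mul, ← Real.fourierInv_eq', h2, mul_zero]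

/-- If zeta has no zeros with `1/2 < Re s < 1`, then the Riemann hypothesis holds. -/
theorem riemannHypothesis_of_forall_ne_zero
    (H : ∀ s : ℂ, 1 / 2 < s.re → s.re < 1 → riemannZeta s ≠ 0) : RiemannHypothesis := by
  intro s hs htriv hs1
  by_contra hre
  have hright : s.re < 1 / 2 := by
    by_contra hlt
    have h2 : 1 / 2 < s.re := lt_of_le_of_ne (not_lt.1 hlt) (Ne.symm hre)
    rcases lt_or_ge s.re 1 with h3 | h3
    · exact H s h2 h3 hs
    · exact riemannZeta_ne_zero_of_one_le_re h3 hs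
  have hre' : (1 - s).re = 1 - s.re := by simp
  have hs0 : s ≠ 0 := fun h => by simp [h, riemannZeta_zero] at hs
  have hζ : riemannZeta (1 - s) ≠ 0 := by
    rcases lt_or_ge (1 - s).re 1 with h3 | h3
    · exact H _ (by rw [hre']; linarith) h3
    · exact riemannZeta_ne_zero_of_one_le_re h3
  have hpos : 0 < (1 - s).re := by rw [hre']; linarith
  have hfe := riemannZeta_one_sub (s := 1 - s)
    (fun n h => by
      rw [h] at hpos
      simp at hpos
      have : (0 : ℝ) ≤ n := n.cast_nonneg
      linarith)
    (fun h => hs0 (by linear_combination -h))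
  rw [sub_sub_cancel, hs] at hfe
  -- In the functional equation at `1 - s` every other factor is nonzero, so the cosine vanishes and
  -- `s = -2k` for an integer `k`.
  have hcos : Complex.cos (Real.pi * (1 - s) / 2) = 0 := by
    have hG := Complex.Gamma_ne_zero_of_re_pos hpos
    have hp : (2 * (Real.pi : ℂ)) ^ (-(1 - s)) ≠ 0 := by
      rw [Complex.cpow_ne_zero_iff]
      left
      exact_mod_cast (by positivity : (0 : ℝ) < 2 * Real.pi).ne'
    simpa [hζ, hG, hp] using hfe.symm
  obtain ⟨k, hk⟩ := Complex.cos_eq_zero_iff.1 hcos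
  have hsk : s = -2 * (k : ℂ) := by
    have hpi : (Real.pi : ℂ) ≠ 0 := by exact_mod_cast Real.pi_ne_zero
    field_simp at hk
    linear_combination -hk
  have hkre : s.re = -2 * (k : ℝ) := by
    rw [hsk]
    simp
  have hk0 : k ≠ 0 := fun h => hs0 (by rw [hsk, h]; simp)
  have hk1 : 0 < k := by
    have : -2 * (k : ℝ) < 1 / 2 := hkre ▸ hright
    have h4 : -1 < k := by
      have : (-1 : ℝ) < k := by linarith
      exact_mod_cast this
    omega
  -- Trivial zeros are indexed as `-2(n + 1)`, hence `n = k - 1`; `k > 0` because `Re s < 1/2` and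
  -- `ζ(0) ≠ 0`.
  refine htriv ⟨(k - 1).toNat, ?_⟩
  have h5 : (((k - 1).toNat : ℤ) : ℂ) = ((k - 1 : ℤ) : ℂ) := by
    rw [Int.toNat_of_nonneg (by omega)]
  rw [Int.cast_natCast] at h5
  rw [h5, hsk]
  push_cast
  ring

theorem RiemannHypothesis.ne_zero (hRH : RiemannHypothesis) {s : ℂ} (h0 : 1 / 2 < s.re)
    (h1 : s.re < 1) : riemannZeta s ≠ 0 := by
  intro hs
  refine h0.ne' (hRH s hs ?_ fun h => by simp [h] at h1)
  rintro ⟨n, rfl⟩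
  simp at h0
  have : (0 : ℝ) ≤ n := n.cast_nonneg
  linarith

/-! ### The theorem -/

theorem theorem1p2 :
    (RiemannHypothesis ↔
      ∀ σ : ℝ, 1 / 2 < σ → σ < 1 → ∀ h : Lp ℂ 2 (volume : Measure ℝ),
        (∀ φ₁ φ₂ : ℝ → ℂ, IsSolution σ h φ₁ → IsSolution σ h φ₂ → φ₁ =ᵐ[volume] φ₂) ∧
        (MemLp (zetaQuotient σ h) 2 (volume : Measure ℝ) → ∃ φ : ℝ → ℂ, IsSolution σ h φ)) ∧
    (∀ σ : ℝ, 1 / 2 < σ → σ < 1 → ∀ h : Lp ℂ 2 (volume : Measure ℝ),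
      ∀ hF : MemLp (zetaQuotient σ h) 2 (volume : Measure ℝ),
        MemLp (explicitSolution σ h hF) 2 (volume : Measure ℝ) ∧
        ∀ φ : ℝ → ℂ, MemLp φ 2 (volume : Measure ℝ) →
          (SolvesEquation σ h φ ↔ φ =ᵐ[volume] explicitSolution σ h hF)) := by
  refine ⟨⟨fun hRH σ h0 h1 h => ⟨fun φ₁ φ₂ hφ₁ hφ₂ => ?_, fun hF => ?_⟩, fun H => ?_⟩,
    fun σ h0 h1 h hF => explicitSolution_spec (by linarith) h1 h hF⟩
  · refine IsSolution.ae_eq (by linarith) h1 (fun s hs => ?_) hφ₁ hφ₂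
    exact hRH.ne_zero (hs ▸ h0) (hs ▸ h1)
  · obtain ⟨hE, hE'⟩ := explicitSolution_spec (by linarith) h1 h hF
    exact ⟨explicitSolution σ h hF, Or.inl hE, (hE' _ hE).2 (ae_eq_refl _)⟩
  -- Only uniqueness at `h = 0` is needed: a zero would make both the exponential and `0` solutions.
  · refine riemannHypothesis_of_forall_ne_zero fun s h0 h1 hs => ?_
    have hsol := isSolution_zero_exp (σ := s.re) (τ := s.im) (by linarith) h1
      (by rw [mul_comm, Complex.re_add_im]; exact hs)
    have hzero : IsSolution s.re ((0 : Lp ℂ 2 (volume : Measure ℝ)) : ℝ → ℂ) 0 := by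
      refine ⟨Or.inl MemLp.zero, ?_⟩
      rw [solvesEquation_iff]
      exact ae_of_all _ fun x => by simp
    obtain ⟨y, hy⟩ := ((H s.re h0 h1 0).1 _ _ hsol hzero).exists
    exact Complex.exp_ne_zero _ hy
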